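/- Let $n\ge 0$ be an integer and let $\lambda_0,\lambda_1,\lambda_2\in\mathbb{C}$ be such that all the zeros $w\in\mathbb{C}$ of $$U(w)=\lambda_0+n\lambda_1 w+\frac{n(n-1)}{2}\lambda_2 w^2$$ lie in the half plane $|w|\le |w-n/2|$. For a complex polynomial $P$ put $$B[P](z)=\lambda_0P(z)+\lambda_1\Big(\frac{nz}{2}\Big)\frac{P'(z)}{1!}+\lambda_2\Big(\frac{nz}{2}\Big)^2\frac{P''(z)}{2!}.$$ Let $0<k\le 1$ and let $P$ be a complex polynomial of degree at most $n$ with no zeros in the disk $|z|<k$. Then for all $\alpha,\beta\in\mathbb{C}$ with $|\alpha|\le 1$, $|\beta|\le 1$, all real $R>r\ge k$, and all $z\in\mathbb{C}$ with $|z|\ge 1$, $$\big|B[P\circ\sigma](z)+\Phi_k\,B[P\circ\rho](z)\big|\le\frac12\left[\frac{|B[z^n](z)|}{k^n}\,\big|R^n+r^n\Phi_k\big|+|1+\Phi_k|\,|\lambda_0|\right]\max_{|w|=k}|P(w)|,$$ where $\sigma(z)=Rz$, $\rho(z)=rz$, $B[z^n](z)$ is the value at $z$ of $B$ applied to the monomial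 $z^n$, and $$\Phi_k=\Phi_k(R,r,\alpha,\beta)=\beta\left\{\Big(\frac{R+k}{k+r}\Big)^n-|\alpha|\right\}-\alpha .$$ -/

import Mathlib

open Polynomial
open scoped Nat

/-- The characteristic polynomial `U(z) = λ₀ + n λ₁ z + (n(n-1)/2) λ₂ z²`. -/
noncomputable def bnChar (n : ℕ) (l₀ l₁ l₂ : ℂ) : ℂ[X] :=
  C l₀ + C ((n : ℂ) * l₁) * X + C ((n : ℂ) * ((n : ℂ) - 1) / 2 * l₂) * X ^ 2

/-- The triple `(λ₀, λ₁, λ₂)` defines an operator of the class `𝓑ₙ`: all the zeros of `U` lie in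
the half plane `|z| ≤ |z - n/2|`. -/
def BnAdmissible (n : ℕ) (l₀ l₁ l₂ : ℂ) : Prop :=
  ∀ w : ℂ, (bnChar n l₀ l₁ l₂).eval w = 0 → ‖w‖ ≤ ‖w - (n : ℂ) / 2‖

/-- The operator
`B[P](z) = λ₀ P(z) + λ₁ (nz/2) P'(z)/1! + λ₂ (nz/2)² P''(z)/2!`. -/
noncomputable def bnOp (n : ℕ) (l₀ l₁ l₂ : ℂ) (P : ℂ[X]) : ℂ[X] :=
  C l₀ * P
    + C l₁ * (C ((n : ℂ) / 2) * X) * (C (1 / ((1 ! : ℕ) : ℂ)) * derivative P)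
    + C l₂ * (C ((n : ℂ) / 2) * X) ^ 2 * (C (1 / ((2 ! : ℕ) : ℂ)) * derivative (derivative P))

/-- `Φₖ(R, r, α, β) = β {((R + k)/(k + r))ⁿ - |α|} - α`. -/
noncomputable def bnPhi (n : ℕ) (k R r : ℝ) (a b : ℂ) : ℂ :=
  b * (((((R + k) / (k + r)) ^ n - ‖a‖ : ℝ)) : ℂ) - a

/-- The maximum of `|P(z)|` on the circle `|z| = k`. -/
noncomputable def maxMod (k : ℝ) (P : ℂ[X]) : ℝ :=
  sSup ((fun w : ℂ => ‖P.eval w‖) '' Metric.sphere (0 : ℂ) k)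

/-- For `k ≥ 0` the supremum in `maxMod` is an attained maximum. -/
theorem maxMod_isGreatest {k : ℝ} (hk : 0 ≤ k) (P : ℂ[X]) :
    IsGreatest ((fun w : ℂ => ‖P.eval w‖) '' Metric.sphere (0 : ℂ) k) (maxMod k P) := by
  have hc : IsCompact ((fun w : ℂ => ‖P.eval w‖) '' Metric.sphere (0 : ℂ) k) :=
    (isCompact_sphere (0 : ℂ) k).image (P.continuous.norm)
  exact hc.isGreatest_sSup ((NormedSpace.sphere_nonempty.mpr hk).image _)

/-! Write `T f = B[f(R·) + b f(r·)]` with `b = Φₖ`; of `b` only `‖b‖ ≤ ((R+k)/(k+r))ⁿ` matters. If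
`G` has degree exactly `n ≥ 1` and all its zeros in `|w| ≤ k`, then `G(R·)` dominates `b G(r·)`
outside the unit disk (`pow_mul_norm_eval_lt`), so the dilate pair has all its zeros in the closed
unit disk. A Laguerre-type argument (`bnOp_eval_ne_zero`) shows that `B` keeps them there. Hence `T`
preserves inequalities `|f| ≤ |F|` on `|w| > k` (`norm_bnOp_dilatePair_le`).

Let `Q` be the reciprocal of `P` in the circle `|w| = k` and let `M > max |P|` on it. Then `|TP| ≤
|TQ| ≤ (M/kⁿ)|T(zⁿ)|`. The shift `P + μM`, `|μ| = 1`, also has no zeros in `|w| < k`, and its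
reciprocal is `Q + conj μ (M/kⁿ) zⁿ`; choosing `arg μ` gives `|TP| - M|T1| ≤ (M/kⁿ)|T(zⁿ)| - |TQ|`.
Adding `|TP| ≤ |TQ|` produces the factor `1/2`. The limit `M → max |P|`, `|z| → 1` finishes the
proof. -/

/-! ### Laguerre-type argument: `B` and zeros in the unit disk -/

theorem exists_eq_prod_linear (G : ℂ[X]) :
    ∃ (ι : Type) (_ : Fintype ι) (a : ι → ℂ), Fintype.card ι = G.natDegree ∧
      G = C G.leadingCoeff * ∏ i, (X - C (a i)) := by
  classical
  have hs := IsAlgClosed.splits G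
  refine ⟨G.roots.ToType, inferInstance, fun x => x.1, ?_, ?_⟩
  · rw [Multiset.card_coe]
    exact splits_iff_card_roots.1 hs
  · have h : ∏ i : G.roots.ToType, (X - C (i.1 : ℂ))
        = (G.roots.map fun a => X - C a).prod := by
      rw [Finset.prod_eq_multiset_prod]
      conv_rhs => rw [← Multiset.map_univ_coe G.roots]
      rw [Multiset.map_map]
      rfl
    rw [h]
    exact hs.eq_prod_roots

/-- The polarised form of Laguerre's theorem for two poles in a half plane. -/
theorem sum_mul_sum_ne_sum_mul {ι : Type*} [Fintype ι] (x : ι → ℂ) (d : ℂ)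
    (hcard : 2 ≤ Fintype.card ι) (hx : ∀ i, 0 < (x i).re) (hd : ∀ i, 0 < (x i).re + d.re) :
    (∑ i, x i) * (∑ i, (x i + d)) ≠ ∑ i, x i * (x i + d) := by
  classical
  intro h
  have hne : Nonempty ι := Fintype.card_pos_iff.1 (by omega)
  set S := ∑ i, x i with hS
  set N : ℝ := (Fintype.card ι : ℝ) with hN
  have hA : S.re = ∑ i, (x i).re := by simp [hS]
  have hApos : 0 < S.re := by
    rw [hA]; exact Finset.sum_pos (fun i _ => hx i) Finset.univ_nonempty
  have h1 : S * (S + N * d) = (∑ i, x i ^ 2) + S * d := by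
    have e1 : ∑ i, (x i + d) = S + N * d := by
      simp [Finset.sum_add_distrib, hS, hN]
    have e2 : ∑ i, x i * (x i + d) = (∑ i, x i ^ 2) + S * d := by
      rw [hS, Finset.sum_mul, ← Finset.sum_add_distrib]
      exact Finset.sum_congr rfl fun i _ => by ring
    rw [← e1, ← e2, h]
  have h2 : Complex.normSq S * (S.re + (N - 1) * d.re)
      = ∑ i, (x i ^ 2 * (starRingEnd ℂ) S).re := by
    have e : (∑ i, x i ^ 2) * (starRingEnd ℂ) S
        = (Complex.normSq S : ℂ) * (S + (N - 1) * d) := by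
      rw [← Complex.mul_conj]
      linear_combination (-(starRingEnd ℂ) S) * h1
    rw [← Complex.re_sum, ← Finset.sum_mul, e]
    simp
  -- The difference of the two sides is the square of `Re x · Im S - Im x · Re S`. This reduces the
  -- claim to real parts, where all terms are positive.
  have h3 : ∀ i, S.re * (x i ^ 2 * (starRingEnd ℂ) S).re
      ≤ (x i).re ^ 2 * Complex.normSq S := by
    intro i
    simp only [pow_two, Complex.mul_re, Complex.mul_im, Complex.conj_re, Complex.conj_im,
      Complex.normSq_apply]
    nlinarith [sq_nonneg ((x i).re * S.im - (x i).im * S.re)]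
  have hSpos : 0 < Complex.normSq S := by
    rw [Complex.normSq_apply]
    nlinarith [mul_self_nonneg S.im, mul_pos hApos hApos]
  have h4 : S.re * (S.re + (N - 1) * d.re) ≤ ∑ i, (x i).re ^ 2 := by
    have : Complex.normSq S * (S.re * (S.re + (N - 1) * d.re))
        ≤ Complex.normSq S * ∑ i, (x i).re ^ 2 := by
      calc _ = S.re * ∑ i, (x i ^ 2 * (starRingEnd ℂ) S).re := by rw [← h2]; ring
        _ = ∑ i, S.re * (x i ^ 2 * (starRingEnd ℂ) S).re := Finset.mul_sum _ _ _
        _ ≤ ∑ i, (x i).re ^ 2 * Complex.normSq S := Finset.sum_le_sum fun i _ => h3 i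
        _ = _ := by rw [← Finset.sum_mul]; ring
    exact le_of_mul_le_mul_left this hSpos
  -- At least two indices are needed for the inner sums to be nonempty.
  have h5 : 0 < ∑ i, (x i).re * ∑ j ∈ Finset.univ.erase i, ((x j).re + d.re) := by
    refine Finset.sum_pos (fun i _ => mul_pos (hx i) (Finset.sum_pos (fun j _ => hd j) ?_))
      Finset.univ_nonempty
    rw [← Finset.card_pos, Finset.card_erase_of_mem (Finset.mem_univ i), Finset.card_univ]
    omega
  have h6 : ∑ i, (x i).re * ∑ j ∈ Finset.univ.erase i, ((x j).re + d.re)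
      = S.re * (S.re + (N - 1) * d.re) - ∑ i, (x i).re ^ 2 := by
    have e : ∀ i, ∑ j ∈ Finset.univ.erase i, ((x j).re + d.re)
        = S.re + (N - 1) * d.re - (x i).re := by
      intro i
      have := Finset.add_sum_erase Finset.univ (fun j => (x j).re + d.re) (Finset.mem_univ i)
      rw [Finset.sum_add_distrib (s := Finset.univ), ← hA] at this
      simp only [Finset.sum_const, Finset.card_univ, nsmul_eq_mul] at this
      linear_combination this
    simp_rw [e, mul_sub, Finset.sum_sub_distrib, ← Finset.sum_mul, ← hA, ← pow_two]
  linarith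

theorem eval_derivative_prod_linear {ι : Type*} (s : Finset ι) (a : ι → ℂ) (z : ℂ)
    (hz : ∀ i ∈ s, z - a i ≠ 0) :
    (derivative (∏ i ∈ s, (X - C (a i)))).eval z
        = (∏ i ∈ s, (z - a i)) * ∑ i ∈ s, 1 / (z - a i) ∧
      (derivative (derivative (∏ i ∈ s, (X - C (a i))))).eval z
        = (∏ i ∈ s, (z - a i)) *
          ((∑ i ∈ s, 1 / (z - a i)) ^ 2 - ∑ i ∈ s, (1 / (z - a i)) ^ 2) := by
  classical
  induction s using Finset.induction_on with
  | empty => simp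
  | insert i s hi ih =>
    obtain ⟨h1, h2⟩ := ih fun j hj => hz j (Finset.mem_insert_of_mem hj)
    have h0 := hz i (Finset.mem_insert_self i s)
    simp only [Finset.prod_insert hi, Finset.sum_insert hi, derivative_mul, derivative_sub,
      derivative_X, derivative_C, derivative_add, eval_add, eval_mul, eval_sub, eval_X, eval_C,
      sub_zero, one_mul, h1, h2, eval_prod]
    constructor
    · field_simp
    · field_simp
      ring

/-- With `u = z/(z-a)` one has `a/z = (u-1)/u`, so the hypothesis says `|u-1| < |u|`. -/
theorem half_lt_re_div_sub {z a : ℂ} (h : ‖a‖ < ‖z‖) : 1 / 2 < (z / (z - a)).re := by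
  have hne : z - a ≠ 0 := by
    intro h0
    rw [sub_eq_zero.1 h0] at h
    exact lt_irrefl _ h
  have hpos : 0 < Complex.normSq (z - a) := Complex.normSq_pos.2 hne
  have h2 : Complex.normSq a < Complex.normSq z := by
    rw [Complex.normSq_eq_norm_sq, Complex.normSq_eq_norm_sq]
    exact pow_lt_pow_left₀ h (norm_nonneg _) two_ne_zero
  rw [Complex.div_re, ← add_div, lt_div_iff₀ hpos]
  simp only [Complex.normSq_apply, Complex.sub_re, Complex.sub_im] at *
  nlinarith

theorem bnOp_eval (n : ℕ) (l₀ l₁ l₂ : ℂ) (P : ℂ[X]) (z : ℂ) :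
    (bnOp n l₀ l₁ l₂ P).eval z = l₀ * P.eval z + l₁ * (n / 2 * z) * (derivative P).eval z
      + l₂ * (n / 2 * z) ^ 2 * (1 / 2 * (derivative (derivative P)).eval z) := by
  simp [bnOp]

/-- The half plane `|w| ≤ |w - n/2|` is `Re w ≤ n/4`. -/
theorem bnChar_eval_ne_zero {n : ℕ} {l₀ l₁ l₂ : ℂ} (hB : BnAdmissible n l₀ l₁ l₂) {w : ℂ}
    (hw : (n : ℝ) / 4 < w.re) (hn : 1 ≤ n) :
    l₀ + n * l₁ * w + n * (n - 1) / 2 * l₂ * w ^ 2 ≠ 0 := by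
  intro h
  have h1 := hB w (by simpa [bnChar] using h)
  have h2 : Complex.normSq w ≤ Complex.normSq (w - n / 2) := by
    rw [Complex.normSq_eq_norm_sq, Complex.normSq_eq_norm_sq]
    exact pow_le_pow_left₀ (norm_nonneg _) h1 2
  have hn' : (1 : ℝ) ≤ n := by exact_mod_cast hn
  have e1 : ((n : ℂ) / 2).re = n / 2 := by simp
  have e2 : ((n : ℂ) / 2).im = 0 := by simp
  rw [Complex.normSq_apply, Complex.normSq_apply, Complex.sub_re, Complex.sub_im, e1, e2] at h2
  nlinarith

/-- An operator of the class `𝓑ₙ` preserves the location of zeros in the closed unit disk. -/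
theorem bnOp_eval_ne_zero {n : ℕ} {l₀ l₁ l₂ : ℂ} (hB : BnAdmissible n l₀ l₁ l₂) (hn : 1 ≤ n)
    {S : ℂ[X]} (hS : S.natDegree = n) (h0 : ∀ w : ℂ, 1 < ‖w‖ → S.eval w ≠ 0) {z : ℂ}
    (hz : 1 < ‖z‖) : (bnOp n l₀ l₁ l₂ S).eval z ≠ 0 := by
  obtain ⟨ι, _, a, hcard, hSa⟩ := exists_eq_prod_linear S
  rw [hS] at hcard
  have ha : ∀ i, ‖a i‖ ≤ 1 := by
    intro i
    by_contra hc
    apply h0 (a i) (not_le.1 hc)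
    rw [hSa, eval_mul, eval_prod, Finset.prod_eq_zero (Finset.mem_univ i) (by simp), mul_zero]
  have hne : ∀ i ∈ Finset.univ, z - a i ≠ 0 := by
    intro i _ hc
    rw [sub_eq_zero.1 hc] at hz
    exact absurd (ha i) (not_le.2 hz)
  obtain ⟨d1, d2⟩ := eval_derivative_prod_linear Finset.univ a z hne
  set u : ι → ℂ := fun i => z / (z - a i) with hu
  have hure : ∀ i, 1 / 2 < (u i).re := fun i => half_lt_re_div_sub ((ha i).trans_lt hz)
  have hSz := h0 z hz
  have s1 : z * ∑ i, 1 / (z - a i) = ∑ i, u i := by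
    rw [Finset.mul_sum]; exact Finset.sum_congr rfl fun i _ => by simp [hu, div_eq_mul_inv]
  have s2 : z ^ 2 * ∑ i, (1 / (z - a i)) ^ 2 = ∑ i, u i ^ 2 := by
    rw [Finset.mul_sum]
    exact Finset.sum_congr rfl fun i _ => by simp [hu, div_eq_mul_inv, mul_pow]
  have hval : (bnOp n l₀ l₁ l₂ S).eval z = S.eval z * (l₀ + l₁ * (n / 2) * ∑ i, u i
      + l₂ * (n ^ 2 / 8) * ((∑ i, u i) ^ 2 - ∑ i, u i ^ 2)) := by
    rw [← s1, ← s2, bnOp_eval, hSa]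
    simp only [derivative_C_mul, eval_C_mul, d1, d2, eval_prod, eval_sub, eval_X, eval_C]
    ring
  rw [hval]
  refine mul_ne_zero hSz ?_
  have hn0 : (n : ℂ) ≠ 0 := by exact_mod_cast (by omega : n ≠ 0)
  have hnr : (0 : ℝ) < n := by exact_mod_cast hn
  have hne' : Nonempty ι := Fintype.card_pos_iff.1 (by omega)
  -- If `U` has no quadratic term, the bracket is just `U((∑ uᵢ)/2)`, and `Re (∑ uᵢ)/2 > n/4`.
  by_cases hl : (n : ℂ) * (n - 1) / 2 * l₂ = 0
  · have hw : (n : ℝ) / 4 < ((∑ i, u i) / 2).re := by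
      have e : ((∑ i, u i) / 2).re = (∑ i, (u i).re) / 2 := by
        rw [← Complex.re_sum]; simp
      have : ∑ _i : ι, (1 / 2 : ℝ) < ∑ i, (u i).re :=
        Finset.sum_lt_sum_of_nonempty Finset.univ_nonempty fun i _ => hure i
      simp only [Finset.sum_const, Finset.card_univ, hcard, nsmul_eq_mul] at this
      rw [e]; linarith
    have := bnChar_eval_ne_zero hB hw hn
    rw [hl] at this
    have hzero : l₂ * ((∑ i, u i) ^ 2 - ∑ i, u i ^ 2) = 0 := by
      rcases mul_eq_zero.1 hl with h | h
      · have hn1 : n = 1 := by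
          have : (n : ℂ) - 1 = 0 := by
            rcases mul_eq_zero.1 ((div_eq_zero_iff.1 h).resolve_right two_ne_zero) with h | h
            · exact absurd h hn0
            · exact h
          exact_mod_cast sub_eq_zero.1 this
        obtain ⟨i, hi⟩ := Fintype.card_eq_one_iff.1 (hcard.trans hn1)
        have huniv : (Finset.univ : Finset ι) = {i} := by
          ext j; simp [hi j]
        simp [huniv]
      · simp [h]
    intro hc
    apply this
    linear_combination hc - (n ^ 2 / 8 : ℂ) * hzero
  · set m := (n : ℂ) * (n - 1) / 2 * l₂ with hm
    have hn2 : 2 ≤ n := by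
      by_contra hc
      have : n = 1 := by omega
      apply hl
      rw [hm, this]; simp
    obtain ⟨s, hs⟩ := IsAlgClosed.exists_pow_nat_eq ((n * l₁) ^ 2 - 4 * m * l₀) two_pos
    set w₁ := (-(n * l₁) + s) / (2 * m) with hw₁
    set w₂ := (-(n * l₁) - s) / (2 * m) with hw₂
    have hsum : m * (w₁ + w₂) = -(n * l₁) := by
      rw [hw₁, hw₂]; field_simp; ring
    have hprod : m * (w₁ * w₂) = l₀ := by
      rw [hw₁, hw₂]; field_simp; linear_combination -hs
    have hroot : ∀ w, m * ((w - w₁) * (w - w₂)) = 0 → w.re ≤ n / 4 := by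
      intro w hw
      by_contra hc
      apply bnChar_eval_ne_zero hB (not_le.1 hc) hn
      rw [← hm]
      linear_combination hw + w * hsum - hprod
    have hr1 := hroot w₁ (by ring)
    have hr2 := hroot w₂ (by ring)
    have hre : ∀ w : ℂ, (2 / (n : ℂ) * w).re = 2 / n * w.re := by
      intro w
      have : (2 / (n : ℂ) * w) = ((2 / n : ℝ) : ℂ) * w := by push_cast; ring
      rw [this, Complex.re_ofReal_mul]
    have hle : ∀ w : ℂ, w.re ≤ n / 4 → (2 / (n : ℂ) * w).re ≤ 1 / 2 := by
      intro w hw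
      rw [hre, div_mul_eq_mul_div, div_le_iff₀ hnr]; linarith
    set v₁ := 2 / (n : ℂ) * w₁ with hv₁
    set v₂ := 2 / (n : ℂ) * w₂ with hv₂
    have h1 := hle w₁ hr1
    have h2 := hle w₂ hr2
    -- With `vⱼ = 2wⱼ/n` for the roots `wⱼ` of `U`, the bracket is `(λ₂n²/8) ∑_{i≠j} (uᵢ - v₁)(uⱼ -
    -- v₂)`, and `Re vⱼ ≤ 1/2 < Re uᵢ`.
    have key := sum_mul_sum_ne_sum_mul (fun i => u i - v₁) (v₁ - v₂) (by omega)
      (fun i => by rw [Complex.sub_re]; linarith [hure i])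
      (fun i => by rw [Complex.sub_re, Complex.sub_re]; linarith [hure i])
    have k1 : ∑ i, (u i - v₁) = ∑ i, u i - n * v₁ := by
      simp [Finset.sum_sub_distrib, hcard]
    have k2 : ∑ i, (u i - v₁ + (v₁ - v₂)) = ∑ i, u i - n * v₂ := by
      simp [Finset.sum_sub_distrib, hcard]
    have k3 : ∑ i, (u i - v₁) * (u i - v₁ + (v₁ - v₂))
        = ∑ i, u i ^ 2 - (v₁ + v₂) * ∑ i, u i + n * (v₁ * v₂) := by
      have : ∀ i, (u i - v₁) * (u i - v₁ + (v₁ - v₂))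
          = u i ^ 2 - (v₁ + v₂) * u i + v₁ * v₂ := fun i => by ring
      simp_rw [this, Finset.sum_add_distrib, Finset.sum_sub_distrib, ← Finset.mul_sum]
      simp [hcard, mul_left_comm]
    rw [k1, k2, k3] at key
    have hl2 : l₂ ≠ 0 := right_ne_zero_of_mul hl
    intro hc
    apply key
    have e1 : n * v₁ = 2 * w₁ := by rw [hv₁]; field_simp
    have e2 : n * v₂ = 2 * w₂ := by rw [hv₂]; field_simp
    have hc' : l₂ * ((n : ℂ) ^ 2 / 8) * ((∑ i, u i - n * v₁) * (∑ i, u i - n * v₂)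
        - (∑ i, u i ^ 2 - (v₁ + v₂) * ∑ i, u i + n * (v₁ * v₂))) = 0 := by
      rw [hm] at hsum hprod
      linear_combination hc + (l₂ * n * (n - 1) / 8) * (e1 * (n * v₂) + 2 * w₁ * e2) + hprod
        - (l₂ * n * (n - 1) / 8 * ∑ i, u i) * (e1 + e2) - (∑ i, u i) / 2 * hsum
    have := (mul_eq_zero.1 hc').resolve_left
      (mul_ne_zero hl2 (div_ne_zero (pow_ne_zero _ hn0) (by norm_num)))
    exact sub_eq_zero.1 this

/-! ### Dilate pairs and the comparison principle -/

theorem bnOp_add (n : ℕ) (l₀ l₁ l₂ : ℂ) (P Q : ℂ[X]) :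
    bnOp n l₀ l₁ l₂ (P + Q) = bnOp n l₀ l₁ l₂ P + bnOp n l₀ l₁ l₂ Q := by
  simp only [bnOp, derivative_add]; ring

theorem bnOp_C_mul (n : ℕ) (l₀ l₁ l₂ c : ℂ) (P : ℂ[X]) :
    bnOp n l₀ l₁ l₂ (C c * P) = C c * bnOp n l₀ l₁ l₂ P := by
  simp only [bnOp, derivative_C_mul]; ring

/-- The combination `P(R·) + b P(r·)` of two dilates of `P`. -/
noncomputable def dilatePair (R r : ℝ) (b : ℂ) (P : ℂ[X]) : ℂ[X] :=
  P.comp (C (R : ℂ) * X) + C b * P.comp (C (r : ℂ) * X)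

theorem dilatePair_add_C_mul (R r : ℝ) (b c : ℂ) (P Q : ℂ[X]) :
    dilatePair R r b (P + C c * Q) = dilatePair R r b P + C c * dilatePair R r b Q := by
  simp only [dilatePair, add_comp, mul_comp, C_comp]; ring

theorem dilatePair_X_pow (R r : ℝ) (b : ℂ) (n : ℕ) :
    dilatePair R r b (X ^ n) = C ((R : ℂ) ^ n + (r : ℂ) ^ n * b) * X ^ n := by
  simp only [dilatePair, pow_comp, X_comp, mul_pow, C_add, C_mul, C_pow]; ring

theorem dilatePair_one (R r : ℝ) (b : ℂ) : dilatePair R r b 1 = C (1 + b) := by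
  simp [dilatePair]

theorem dilatePair_eval (R r : ℝ) (b : ℂ) (P : ℂ[X]) (z : ℂ) :
    (dilatePair R r b P).eval z = P.eval (R * z) + b * P.eval (r * z) := by
  simp [dilatePair]

theorem dilatePair_coeff (R r : ℝ) (b : ℂ) (P : ℂ[X]) (m : ℕ) :
    (dilatePair R r b P).coeff m = P.coeff m * ((R : ℂ) ^ m + b * (r : ℂ) ^ m) := by
  rw [dilatePair, coeff_add, coeff_C_mul, comp_C_mul_X_coeff, comp_C_mul_X_coeff]
  ring

/-- The extremal configuration is `|z| = 1`, `a = -kz`, where equality would hold. The squares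
differ by `(R-r)²|kz+a|²` plus a multiple of a quantity bounded below by `(k|z|-|a|)(r|z|+|a|) > 0`.
-/
theorem add_mul_norm_sub_lt {k r R : ℝ} (hk : 0 < k) (hr : k ≤ r) (hR : r < R) {z a : ℂ}
    (hz : 1 < ‖z‖) (ha : ‖a‖ ≤ k) : (R + k) * ‖r * z - a‖ < (r + k) * ‖R * z - a‖ := by
  set t := ‖z‖ with ht
  set s := ‖a‖ with hs
  have ht2 : t ^ 2 = z.re * z.re + z.im * z.im := by
    rw [ht, ← Complex.normSq_eq_norm_sq, Complex.normSq_apply]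
  have hs2 : s ^ 2 = a.re * a.re + a.im * a.im := by
    rw [hs, ← Complex.normSq_eq_norm_sq, Complex.normSq_apply]
  have hs0 : 0 ≤ s := norm_nonneg _
  have hc : -(t * s) ≤ z.re * a.re + z.im * a.im := by
    have := Complex.abs_re_le_norm (z * (starRingEnd ℂ) a)
    rw [norm_mul, RCLike.norm_conj, Complex.mul_re, Complex.conj_re, Complex.conj_im] at this
    have := (abs_le.1 this).1
    linarith
  have hpos : 0 < (k * t - s) * (r * t + s) :=
    mul_pos (by nlinarith) (by nlinarith)
  have hinner : 0 < r * k * t ^ 2 - s ^ 2 + (r - k) * (z.re * a.re + z.im * a.im) := by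
    have := mul_le_mul_of_nonneg_left hc (sub_nonneg.2 hr)
    nlinarith
  have hRr : 0 < (R + k) * (R - r) := mul_pos (by linarith) (by linarith)
  have hprod := mul_pos hRr hinner
  refine lt_of_pow_lt_pow_left₀ 2 (mul_nonneg (by linarith) (norm_nonneg _)) ?_
  rw [mul_pow, mul_pow, ← Complex.normSq_eq_norm_sq, ← Complex.normSq_eq_norm_sq,
    Complex.normSq_apply, Complex.normSq_apply]
  simp only [Complex.sub_re, Complex.sub_im, Complex.re_ofReal_mul, Complex.im_ofReal_mul]
  rw [ht2, hs2] at hprod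
  have q : 0 ≤ (R - r) ^ 2 * ((k * z.re + a.re) ^ 2 + (k * z.im + a.im) ^ 2) := by positivity
  linear_combination q + 2 * hprod

theorem pow_mul_norm_eval_lt {k r R : ℝ} (hk : 0 < k) (hr : k ≤ r) (hR : r < R) {G : ℂ[X]}
    (hdeg : 1 ≤ G.natDegree) (hG : ∀ w : ℂ, k < ‖w‖ → G.eval w ≠ 0) {z : ℂ} (hz : 1 < ‖z‖) :
    ((R + k) / (k + r)) ^ G.natDegree * ‖G.eval (r * z)‖ < ‖G.eval (R * z)‖ := by
  obtain ⟨ι, _, a, hcard, hGa⟩ := exists_eq_prod_linear G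
  have hne : Nonempty ι := Fintype.card_pos_iff.1 (by omega)
  have ha : ∀ i, ‖a i‖ ≤ k := by
    intro i
    by_contra hc
    apply hG (a i) (not_le.1 hc)
    rw [hGa, eval_mul, eval_prod, Finset.prod_eq_zero (Finset.mem_univ i) (by simp), mul_zero]
  have hlead : 0 < ‖G.leadingCoeff‖ := by
    rw [norm_pos_iff, leadingCoeff_ne_zero]
    rintro rfl
    simp at hdeg
  have hev : ∀ w, ‖G.eval w‖ = ‖G.leadingCoeff‖ * ∏ i, ‖w - a i‖ := by
    intro w
    conv_lhs => rw [hGa]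
    simp [eval_prod]
  have hkr : 0 < k + r := by linarith
  rw [hev, hev, mul_left_comm]
  refine mul_lt_mul_of_pos_left ?_ hlead
  rw [← hcard, ← Finset.card_univ, ← Finset.prod_const, ← Finset.prod_mul_distrib]
  refine Finset.prod_lt_prod_of_nonempty (fun i _ => mul_pos (div_pos (by linarith) hkr) ?_)
    (fun i _ => ?_) Finset.univ_nonempty
  · rw [norm_pos_iff, sub_ne_zero]
    intro h
    have h1 := ha i
    rw [← h, norm_mul, Complex.norm_real, Real.norm_of_nonneg (by linarith)] at h1
    nlinarith
  · rw [div_mul_eq_mul_div, div_lt_iff₀ hkr, mul_comm ‖_‖, add_comm k]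
    exact add_mul_norm_sub_lt hk hr hR hz (ha i)

theorem bnOp_dilatePair_eval_ne_zero {n : ℕ} {l₀ l₁ l₂ : ℂ} (hB : BnAdmissible n l₀ l₁ l₂)
    (hn : 1 ≤ n) {k r R : ℝ} (hk : 0 < k) (hr : k ≤ r) (hR : r < R) {b : ℂ}
    (hb : ‖b‖ ≤ ((R + k) / (k + r)) ^ n) {G : ℂ[X]} (hdeg : G.natDegree ≤ n)
    (hcoeff : G.coeff n ≠ 0) (hG : ∀ w : ℂ, k < ‖w‖ → G.eval w ≠ 0) {z : ℂ} (hz : 1 < ‖z‖) :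
    (bnOp n l₀ l₁ l₂ (dilatePair R r b G)).eval z ≠ 0 := by
  have hGn : G.natDegree = n := le_antisymm hdeg (le_natDegree_of_ne_zero hcoeff)
  refine bnOp_eval_ne_zero hB hn (le_antisymm ?_ (le_natDegree_of_ne_zero ?_)) ?_ hz
  · refine natDegree_le_iff_coeff_eq_zero.2 fun m hm => ?_
    rw [dilatePair_coeff, coeff_eq_zero_of_natDegree_lt (hdeg.trans_lt hm), zero_mul]
  · rw [dilatePair_coeff]
    refine mul_ne_zero hcoeff fun h => ?_
    -- The leading coefficient survives because `(R+k)r < R(k+r)`, so `‖b‖ rⁿ < Rⁿ`.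
    have h1 : R ^ n = ‖b‖ * r ^ n := by
      have := congrArg norm (eq_neg_of_add_eq_zero_left h)
      rwa [norm_neg, norm_mul, norm_pow, norm_pow, Complex.norm_real, Complex.norm_real,
        Real.norm_of_nonneg (by linarith), Real.norm_of_nonneg (by linarith)] at this
    have h2 : ‖b‖ * r ^ n ≤ ((R + k) / (k + r) * r) ^ n := by
      rw [mul_pow]
      exact mul_le_mul_of_nonneg_right hb (pow_nonneg (by linarith) _)
    have h3 : ((R + k) / (k + r) * r) ^ n < R ^ n := by
      refine pow_lt_pow_left₀ ?_ (mul_nonneg (div_nonneg (by linarith) (by linarith))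
        (by linarith)) (by omega)
      rw [div_mul_eq_mul_div, div_lt_iff₀ (by linarith)]
      nlinarith
    linarith
  · intro w hw h
    rw [dilatePair_eval] at h
    have h1 := pow_mul_norm_eval_lt hk hr hR (by omega) hG hw
    rw [hGn, eq_neg_of_add_eq_zero_left h, norm_neg, norm_mul] at h1
    have := mul_le_mul_of_nonneg_right hb (norm_nonneg (G.eval (r * w)))
    linarith

/-- The operator `f ↦ B[f(R·) + b f(r·)]` preserves inequalities between moduli. -/
theorem norm_bnOp_dilatePair_le {n : ℕ} {l₀ l₁ l₂ : ℂ} (hB : BnAdmissible n l₀ l₁ l₂)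
    (hn : 1 ≤ n) {k r R : ℝ} (hk : 0 < k) (hr : k ≤ r) (hR : r < R) {b : ℂ}
    (hb : ‖b‖ ≤ ((R + k) / (k + r)) ^ n) {f F : ℂ[X]} (hf : f.natDegree ≤ n)
    (hF : F.natDegree ≤ n) (hFn : F.coeff n ≠ 0) (hF0 : ∀ w : ℂ, k < ‖w‖ → F.eval w ≠ 0)
    (hcoeff : ‖f.coeff n‖ ≤ ‖F.coeff n‖) (hle : ∀ w : ℂ, k < ‖w‖ → ‖f.eval w‖ ≤ ‖F.eval w‖)
    {z : ℂ} (hz : 1 < ‖z‖) :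
    ‖(bnOp n l₀ l₁ l₂ (dilatePair R r b f)).eval z‖
      ≤ ‖(bnOp n l₀ l₁ l₂ (dilatePair R r b F)).eval z‖ := by
  by_contra! hlt
  have hTF := bnOp_dilatePair_eval_ne_zero hB hn hk hr hR hb hF hFn hF0 hz
  set A := (bnOp n l₀ l₁ l₂ (dilatePair R r b f)).eval z with hA
  set D := (bnOp n l₀ l₁ l₂ (dilatePair R r b F)).eval z with hD
  have hδ : 1 < ‖A / D‖ := by
    rw [norm_div, one_lt_div (norm_pos_iff.2 hTF)]; exact hlt
  have hne : ∀ x y : ℂ, ‖x‖ ≤ ‖y‖ → y ≠ 0 → x + -(A / D) * y ≠ 0 := by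
    intro x y hxy hy h
    have h1 : ‖x‖ = ‖A / D‖ * ‖y‖ := by
      rw [← norm_mul]
      exact congrArg norm (by linear_combination h)
    have := norm_pos_iff.2 hy
    nlinarith
  -- As `|A/D| > 1`, the polynomial `f - (A/D)F` keeps degree `n` and has no zeros in `|w| > k`, yet
  -- its image under the operator vanishes at `z`.
  refine bnOp_dilatePair_eval_ne_zero hB hn hk hr hR hb (G := f + C (-(A / D)) * F)
    ((natDegree_add_le _ _).trans (max_le hf ((natDegree_C_mul_le _ _).trans hF))) ?_ ?_ hz ?_
  · rw [coeff_add, coeff_C_mul]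
    exact hne _ _ hcoeff hFn
  · intro w hw
    rw [eval_add, eval_mul, eval_C]
    exact hne _ _ (hle w hw) (hF0 w hw)
  · rw [dilatePair_add_C_mul, bnOp_add, bnOp_C_mul, eval_add, eval_mul, eval_C, ← hA, ← hD]
    field_simp
    ring

/-! ### Reciprocal polynomial with respect to the circle `|z| = k` -/

/-- The polynomial `(z / k)ⁿ conj (P (k² / conj z))`. -/
noncomputable def circleReciprocal (n : ℕ) (k : ℝ) (P : ℂ[X]) : ℂ[X] :=
  C (((k : ℂ) ^ n)⁻¹) * reflect n ((P.map (starRingEnd ℂ)).comp (C ((k : ℂ) ^ 2) * X))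

theorem natDegree_map_conj_comp_le {n : ℕ} {k : ℝ} {P : ℂ[X]} (hdeg : P.natDegree ≤ n) :
    ((P.map (starRingEnd ℂ)).comp (C ((k : ℂ) ^ 2) * X)).natDegree ≤ n := by
  refine natDegree_le_iff_coeff_eq_zero.2 fun m hm => ?_
  rw [comp_C_mul_X_coeff, coeff_map, coeff_eq_zero_of_natDegree_lt (hdeg.trans_lt hm), map_zero,
    zero_mul]

theorem circleReciprocal_natDegree_le {n : ℕ} {k : ℝ} {P : ℂ[X]} (hdeg : P.natDegree ≤ n) :
    (circleReciprocal n k P).natDegree ≤ n :=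
  (natDegree_C_mul_le _ _).trans
    (natDegree_reflect_le.trans (max_le le_rfl (natDegree_map_conj_comp_le hdeg)))

theorem circleReciprocal_coeff (n : ℕ) (k : ℝ) (P : ℂ[X]) :
    (circleReciprocal n k P).coeff n = ((k : ℂ) ^ n)⁻¹ * (starRingEnd ℂ) (P.eval 0) := by
  rw [circleReciprocal, coeff_C_mul, coeff_reflect, revAt_le le_rfl, Nat.sub_self,
    comp_C_mul_X_coeff, coeff_map, coeff_zero_eq_eval_zero, pow_zero, mul_one]

theorem circleReciprocal_eval {n : ℕ} {k : ℝ} {P : ℂ[X]} (hdeg : P.natDegree ≤ n) {z : ℂ}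
    (hz : z ≠ 0) : (circleReciprocal n k P).eval z
      = (z / k) ^ n * (starRingEnd ℂ) (P.eval ((k : ℂ) ^ 2 / (starRingEnd ℂ) z)) := by
  let _ : Invertible z⁻¹ := invertibleOfNonzero (inv_ne_zero hz)
  have h := eval₂_reflect_mul_pow (RingHom.id ℂ) z⁻¹ n _
    (natDegree_map_conj_comp_le (k := k) hdeg)
  rw [invOf_eq_inv, inv_inv, ← eval, ← eval, eval_comp] at h
  have h2 : (P.map (starRingEnd ℂ)).eval ((C ((k : ℂ) ^ 2) * X).eval z⁻¹)
      = (starRingEnd ℂ) (P.eval ((k : ℂ) ^ 2 / (starRingEnd ℂ) z)) := by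
    have e : (C ((k : ℂ) ^ 2) * X).eval z⁻¹
        = (starRingEnd ℂ) ((k : ℂ) ^ 2 / (starRingEnd ℂ) z) := by
      simp [div_eq_mul_inv]
    rw [e, eval_map, eval₂_hom]
  rw [h2] at h
  rw [circleReciprocal, eval_mul, eval_C, ← h, div_pow, inv_pow]
  field_simp

theorem norm_circleReciprocal_eval {n : ℕ} {k : ℝ} (hk : 0 < k) {P : ℂ[X]}
    (hdeg : P.natDegree ≤ n) {z : ℂ} (hz : z ≠ 0) : ‖(circleReciprocal n k P).eval z‖
      = (‖z‖ / k) ^ n * ‖P.eval ((k : ℂ) ^ 2 / (starRingEnd ℂ) z)‖ := by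
  rw [circleReciprocal_eval hdeg hz, norm_mul, norm_pow, norm_div, RCLike.norm_conj,
    Complex.norm_real, Real.norm_of_nonneg hk.le]

theorem norm_sq_div_conj_lt {k : ℝ} (hk : 0 < k) {z : ℂ} (hz : k < ‖z‖) :
    ‖(k : ℂ) ^ 2 / (starRingEnd ℂ) z‖ < k := by
  rw [norm_div, norm_pow, RCLike.norm_conj, Complex.norm_real, Real.norm_of_nonneg hk.le,
    div_lt_iff₀ (hk.trans hz), pow_two]
  exact mul_lt_mul_of_pos_left hz hk

theorem circleReciprocal_add_C (n : ℕ) (k : ℝ) (c : ℂ) (P : ℂ[X]) :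
    circleReciprocal n k (P + C c * 1)
      = circleReciprocal n k P + C ((starRingEnd ℂ) c * ((k : ℂ) ^ n)⁻¹) * X ^ n := by
  simp only [circleReciprocal, mul_one, Polynomial.map_add, map_C, add_comp, C_comp, reflect_add,
    reflect_C, mul_add, C_mul]
  ring

theorem circleReciprocal_eval_ne_zero {n : ℕ} {k : ℝ} (hk : 0 < k) {P : ℂ[X]}
    (hdeg : P.natDegree ≤ n) (hP : ∀ w : ℂ, ‖w‖ < k → P.eval w ≠ 0) {z : ℂ} (hz : k < ‖z‖) :
    (circleReciprocal n k P).eval z ≠ 0 := by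
  have hz0 : z ≠ 0 := norm_pos_iff.1 (hk.trans hz)
  rw [← norm_pos_iff, norm_circleReciprocal_eval hk hdeg hz0]
  exact mul_pos (pow_pos (div_pos (hk.trans hz) hk) _)
    (norm_pos_iff.2 (hP _ (norm_sq_div_conj_lt hk hz)))

/-- After clearing denominators, the squares differ by `(|z|²-k²)(|a|²-k²)`. -/
theorem norm_sub_le_of_le_norm {k : ℝ} (hk : 0 < k) {z a : ℂ} (hz : k < ‖z‖) (ha : k ≤ ‖a‖) :
    ‖z - a‖ ≤ ‖z‖ / k * ‖(k : ℂ) ^ 2 / (starRingEnd ℂ) z - a‖ := by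
  have hz0 : z ≠ 0 := norm_pos_iff.1 (hk.trans hz)
  have hc0 : (starRingEnd ℂ) z ≠ 0 := (_root_.map_ne_zero _).2 hz0
  have e : ‖z‖ * ‖(k : ℂ) ^ 2 / (starRingEnd ℂ) z - a‖
      = ‖(k : ℂ) ^ 2 - (starRingEnd ℂ) z * a‖ := by
    rw [← RCLike.norm_conj z, ← norm_mul, mul_sub, mul_div_cancel₀ _ hc0]
  rw [div_mul_eq_mul_div, le_div_iff₀ hk, e]
  refine le_of_sq_le_sq ?_ (norm_nonneg _)
  have h1 : k ^ 2 ≤ Complex.normSq z := by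
    rw [Complex.normSq_eq_norm_sq]; exact pow_le_pow_left₀ hk.le hz.le 2
  have h2 : k ^ 2 ≤ Complex.normSq a := by
    rw [Complex.normSq_eq_norm_sq]; exact pow_le_pow_left₀ hk.le ha 2
  have h3 := mul_nonneg (sub_nonneg.2 h1) (sub_nonneg.2 h2)
  rw [mul_pow, ← Complex.normSq_eq_norm_sq, ← Complex.normSq_eq_norm_sq]
  have e1 : ((k : ℂ) ^ 2).re = k ^ 2 := by rw [← Complex.ofReal_pow, Complex.ofReal_re]
  have e2 : ((k : ℂ) ^ 2).im = 0 := by rw [← Complex.ofReal_pow, Complex.ofReal_im]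
  simp only [Complex.normSq_apply, Complex.sub_re, Complex.sub_im, Complex.mul_re,
    Complex.mul_im, Complex.conj_re, Complex.conj_im, e1, e2] at *
  linear_combination h3

/-- Both bounds are compared root by root; when `deg P < n` the spare factors `|z|/k` exceed `1`. -/
theorem norm_eval_le_circleReciprocal {n : ℕ} {k : ℝ} (hk : 0 < k) {P : ℂ[X]}
    (hdeg : P.natDegree ≤ n) (hP : ∀ w : ℂ, ‖w‖ < k → P.eval w ≠ 0) :
    (∀ z : ℂ, k < ‖z‖ → ‖P.eval z‖ ≤ ‖(circleReciprocal n k P).eval z‖) ∧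
      ‖P.coeff n‖ ≤ ‖(circleReciprocal n k P).coeff n‖ := by
  obtain ⟨ι, _, a, hcard, hPa⟩ := exists_eq_prod_linear P
  have ha : ∀ i, k ≤ ‖a i‖ := by
    intro i
    by_contra hc
    apply hP (a i) (not_le.1 hc)
    rw [hPa, eval_mul, eval_prod, Finset.prod_eq_zero (Finset.mem_univ i) (by simp), mul_zero]
  have hev : ∀ w, ‖P.eval w‖ = ‖P.leadingCoeff‖ * ∏ i, ‖w - a i‖ := by
    intro w
    conv_lhs => rw [hPa]
    simp [eval_prod]
  constructor
  · intro z hz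
    have hz0 : z ≠ 0 := norm_pos_iff.1 (hk.trans hz)
    rw [norm_circleReciprocal_eval hk hdeg hz0]
    calc ‖P.eval z‖ ≤ (‖z‖ / k) ^ P.natDegree * ‖P.eval ((k : ℂ) ^ 2 / (starRingEnd ℂ) z)‖ := by
          rw [hev, hev, mul_left_comm, ← hcard, ← Finset.card_univ, ← Finset.prod_const,
            ← Finset.prod_mul_distrib]
          exact mul_le_mul_of_nonneg_left (Finset.prod_le_prod (fun i _ => norm_nonneg _)
            fun i _ => norm_sub_le_of_le_norm hk hz (ha i)) (norm_nonneg _)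
      _ ≤ _ := by
          refine mul_le_mul_of_nonneg_right (pow_le_pow_right₀ ?_ hdeg) (norm_nonneg _)
          rw [one_le_div hk]; exact hz.le
  · rcases hdeg.lt_or_eq with h | h
    · rw [coeff_eq_zero_of_natDegree_lt h, norm_zero]; exact norm_nonneg _
    · rw [circleReciprocal_coeff, norm_mul, RCLike.norm_conj, norm_inv, norm_pow,
        Complex.norm_real, Real.norm_of_nonneg hk.le, hev, ← h, coeff_natDegree,
        le_inv_mul_iff₀ (pow_pos hk _), mul_comm]
      refine mul_le_mul_of_nonneg_left ?_ (norm_nonneg _)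
      rw [← hcard, ← Finset.card_univ, ← Finset.prod_const]
      refine Finset.prod_le_prod (fun i _ => hk.le) fun i _ => ?_
      rw [zero_sub, norm_neg]
      exact ha i

/-! ### Maximum modulus and the final estimate -/

theorem norm_eval_le_maxMod {k : ℝ} (hk : 0 < k) (P : ℂ[X]) {w : ℂ} (hw : ‖w‖ ≤ k) :
    ‖P.eval w‖ ≤ maxMod k P := by
  refine Complex.norm_le_of_forall_mem_frontier_norm_le (f := fun w => P.eval w)
    (U := Metric.ball (0 : ℂ) k) Metric.isBounded_ball P.differentiable.diffContOnCl ?_ ?_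
  · intro z hz
    rw [frontier_ball _ hk.ne'] at hz
    exact (maxMod_isGreatest hk.le P).2 ⟨z, hz, rfl⟩
  · rw [closure_ball _ hk.ne']
    simpa using hw

theorem exists_norm_add_conj_mul {A E : ℂ} (h : ‖A‖ ≤ ‖E‖) :
    ∃ μ : ℂ, ‖μ‖ = 1 ∧ ‖A + (starRingEnd ℂ) μ * E‖ = ‖E‖ - ‖A‖ := by
  by_cases hA : A = 0
  · exact ⟨1, by simp, by simp [hA]⟩
  have hA0 : 0 < ‖A‖ := norm_pos_iff.2 hA
  have hE0 : 0 < ‖E‖ := hA0.trans_le h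
  have hE : E ≠ 0 := norm_pos_iff.1 hE0
  refine ⟨(starRingEnd ℂ) (-(A / E) * ((‖E‖ / ‖A‖ : ℝ) : ℂ)), ?_, ?_⟩
  · rw [RCLike.norm_conj, norm_mul, norm_neg, norm_div, Complex.norm_real,
      Real.norm_of_nonneg (by positivity)]
    field_simp
  · rw [Complex.conj_conj]
    have e : A + -(A / E) * ((‖E‖ / ‖A‖ : ℝ) : ℂ) * E = A * ((1 - ‖E‖ / ‖A‖ : ℝ) : ℂ) := by
      push_cast
      field_simp
      ring
    rw [e, norm_mul, Complex.norm_real, Real.norm_of_nonpos]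
    · field_simp
      ring
    · rw [sub_nonpos, one_le_div hA0]; exact h

theorem norm_bnOp_dilatePair_le_of_maxMod_lt {n : ℕ} {l₀ l₁ l₂ : ℂ}
    (hB : BnAdmissible n l₀ l₁ l₂) (hn : 1 ≤ n) {k r R : ℝ} (hk : 0 < k) (hr : k ≤ r)
    (hR : r < R) {b : ℂ} (hb : ‖b‖ ≤ ((R + k) / (k + r)) ^ n) {P : ℂ[X]}
    (hdeg : P.natDegree ≤ n) (hP : ∀ w : ℂ, ‖w‖ < k → P.eval w ≠ 0) {M : ℝ}
    (hM : maxMod k P < M) {z : ℂ} (hz : 1 < ‖z‖) :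
    ‖(bnOp n l₀ l₁ l₂ (dilatePair R r b P)).eval z‖
      ≤ 1 / 2 * (‖(bnOp n l₀ l₁ l₂ (X ^ n)).eval z‖ / k ^ n * ‖(R : ℂ) ^ n + (r : ℂ) ^ n * b‖
          + ‖1 + b‖ * ‖l₀‖) * M := by
  have hMpos : 0 < M := by
    refine lt_of_le_of_lt ((norm_nonneg _).trans (norm_eval_le_maxMod hk P (w := 0) ?_)) hM
    simpa using hk.le
  have hkn : 0 < k ^ n := pow_pos hk n
  have hknorm : ‖((k : ℂ) ^ n)⁻¹‖ = (k ^ n)⁻¹ := by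
    rw [norm_inv, norm_pow, Complex.norm_real, Real.norm_of_nonneg hk.le]
  set T : ℂ[X] → ℂ := fun f => (bnOp n l₀ l₁ l₂ (dilatePair R r b f)).eval z with hT
  have hTadd : ∀ f g c, T (f + C c * g) = T f + c * T g := by
    intro f g c
    simp only [hT, dilatePair_add_C_mul, bnOp_add, bnOp_C_mul, eval_add, eval_mul, eval_C]
  have hTmul : ∀ g c, T (C c * g) = c * T g := by
    intro g c
    have h0 : T 0 = 0 := by simp [hT, dilatePair, bnOp]
    have := hTadd 0 g c
    rwa [zero_add, h0, zero_add] at this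
  have hT1 : T 1 = (1 + b) * l₀ := by
    simp [hT, dilatePair_one, bnOp]
    ring
  have hTX : T (X ^ n) = ((R : ℂ) ^ n + (r : ℂ) ^ n * b) * (bnOp n l₀ l₁ l₂ (X ^ n)).eval z := by
    simp only [hT, dilatePair_X_pow, bnOp_C_mul, eval_mul, eval_C]
  set Q := circleReciprocal n k P with hQ
  have hQdeg : Q.natDegree ≤ n := circleReciprocal_natDegree_le hdeg
  have hcoeff_ne : ∀ {p : ℂ[X]}, (∀ w : ℂ, ‖w‖ < k → p.eval w ≠ 0) →
      (circleReciprocal n k p).coeff n ≠ 0 := by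
    intro p hp
    rw [circleReciprocal_coeff]
    exact mul_ne_zero (inv_ne_zero (pow_ne_zero _ (Complex.ofReal_ne_zero.2 hk.ne')))
      ((_root_.map_ne_zero _).2 (hp 0 (by simpa using hk)))
  have hTle : ∀ {p : ℂ[X]}, p.natDegree ≤ n → (∀ w : ℂ, ‖w‖ < k → p.eval w ≠ 0) →
      ‖T p‖ ≤ ‖T (circleReciprocal n k p)‖ := by
    intro p hpdeg hp
    obtain ⟨h1, h2⟩ := norm_eval_le_circleReciprocal hk hpdeg hp
    exact norm_bnOp_dilatePair_le hB hn hk hr hR hb hpdeg (circleReciprocal_natDegree_le hpdeg)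
      (hcoeff_ne hp) (fun w hw => circleReciprocal_eval_ne_zero hk hpdeg hp hw) h2 h1 hz
  have hPQ : ‖T P‖ ≤ ‖T Q‖ := hTle hdeg hP
  set e : ℂ := (M : ℂ) * ((k : ℂ) ^ n)⁻¹ with he
  have henorm : ‖e‖ = M * (k ^ n)⁻¹ := by
    rw [he, norm_mul, hknorm, Complex.norm_real, Real.norm_of_nonneg hMpos.le]
  have hene : e ≠ 0 := by
    rw [← norm_pos_iff, henorm]; positivity
  -- Outside `|w| = k`, `|Q(w)| ≤ (|w|/k)ⁿ M`, so `Q` is compared with `(M/kⁿ) zⁿ`.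
  have hQX : ‖T Q‖ ≤ ‖e * T (X ^ n)‖ := by
    rw [← hTmul]
    refine norm_bnOp_dilatePair_le hB hn hk hr hR hb hQdeg
      ((natDegree_C_mul_le _ _).trans (natDegree_X_pow_le _)) ?_ ?_ ?_ ?_ hz
    · simpa using hene
    · intro w hw
      simp only [eval_mul, eval_C, eval_pow, eval_X]
      exact mul_ne_zero hene (pow_ne_zero _ (norm_pos_iff.1 (hk.trans hw)))
    · rw [hQ, circleReciprocal_coeff, coeff_C_mul, coeff_X_pow_self, mul_one, henorm, norm_mul,
        hknorm, RCLike.norm_conj, mul_comm]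
      exact mul_le_mul_of_nonneg_right ((norm_eval_le_maxMod hk P (by simpa using hk.le)).trans
        hM.le) (inv_nonneg.2 hkn.le)
    · intro w hw
      rw [hQ, norm_circleReciprocal_eval hk hdeg (norm_pos_iff.1 (hk.trans hw)), eval_mul, eval_C,
        eval_pow, eval_X, norm_mul, henorm, norm_pow, div_pow]
      have := (norm_eval_le_maxMod hk P (norm_sq_div_conj_lt hk hw).le).trans hM.le
      calc _ ≤ ‖w‖ ^ n / k ^ n * M := mul_le_mul_of_nonneg_left this (by positivity)
        _ = _ := by rw [div_eq_mul_inv]; ring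
  obtain ⟨μ, hμ, hμE⟩ := exists_norm_add_conj_mul hQX
  have hμM : ‖μ * M‖ = M := by
    rw [norm_mul, hμ, one_mul, Complex.norm_real, Real.norm_of_nonneg hMpos.le]
  -- The strict inequality `maxMod k P < M` keeps the shifted polynomial free of zeros in `|w| < k`.
  have hshift := hTle (p := P + C (μ * M) * 1)
    ((natDegree_add_le _ _).trans (max_le hdeg (by rw [mul_one, natDegree_C]; exact Nat.zero_le n))) (by
      intro w hw h
      rw [eval_add, mul_one, eval_C] at h
      have h1 := norm_eval_le_maxMod hk P hw.le
      rw [eq_neg_of_add_eq_zero_left h, norm_neg, hμM] at h1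
      linarith)
  rw [circleReciprocal_add_C, hTadd, hTadd, ← hQ, map_mul, Complex.conj_ofReal,
    mul_assoc ((starRingEnd ℂ) μ), ← he, mul_assoc ((starRingEnd ℂ) μ), hμE] at hshift
  have htri : ‖T P‖ - M * ‖T 1‖ ≤ ‖T P + μ * M * T 1‖ := by
    have := norm_sub_norm_le (T P) (-(μ * M * T 1))
    rwa [norm_neg, norm_mul, hμM, sub_neg_eq_add] at this
  rw [norm_mul, henorm, hTX, norm_mul, hT1] at hshift
  rw [hT1, norm_mul] at htri
  have : ‖T P‖ + ‖T P‖ ≤ M * (k ^ n)⁻¹ * (‖(R : ℂ) ^ n + (r : ℂ) ^ n * b‖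
      * ‖(bnOp n l₀ l₁ l₂ (X ^ n)).eval z‖) + M * (‖1 + b‖ * ‖l₀‖) := by
    linarith
  rw [div_eq_mul_inv]
  linear_combination 1 / 2 * this

/-- With `K = ((R+k)/(k+r))ⁿ ≥ 1 ≥ |α|`, one has `|Φₖ| ≤ |β|(K-|α|) + |α| ≤ K`. -/
theorem norm_bnPhi_le (n : ℕ) {k R r : ℝ} {a b : ℂ} (hk : 0 < k) (hr : k ≤ r) (hR : r < R)
    (ha : ‖a‖ ≤ 1) (hb : ‖b‖ ≤ 1) : ‖bnPhi n k R r a b‖ ≤ ((R + k) / (k + r)) ^ n := by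
  have h1 : 1 ≤ ((R + k) / (k + r)) ^ n :=
    one_le_pow₀ ((one_le_div (by linarith)).2 (by linarith))
  have h2 : 0 ≤ ((R + k) / (k + r)) ^ n - ‖a‖ := by linarith
  refine (norm_sub_le _ _).trans ?_
  rw [norm_mul, Complex.norm_real, Real.norm_of_nonneg h2]
  nlinarith

theorem theorem2p6 (n : ℕ) (l₀ l₁ l₂ : ℂ) (hB : BnAdmissible n l₀ l₁ l₂)
    (P : ℂ[X]) (hdeg : P.natDegree ≤ n)
    (k : ℝ) (hk0 : 0 < k) (hk1 : k ≤ 1)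
    (hP : ∀ w : ℂ, ‖w‖ < k → P.eval w ≠ 0)
    (α β : ℂ) (hα : ‖α‖ ≤ 1) (hβ : ‖β‖ ≤ 1)
    (R r : ℝ) (hr : k ≤ r) (hR : r < R)
    (z : ℂ) (hz : 1 ≤ ‖z‖) :
    ‖(bnOp n l₀ l₁ l₂ (P.comp (C (R : ℂ) * X))).eval z
        + bnPhi n k R r α β * (bnOp n l₀ l₁ l₂ (P.comp (C (r : ℂ) * X))).eval z‖
      ≤ 1 / 2 *
        (‖(bnOp n l₀ l₁ l₂ (X ^ n)).eval z‖ / k ^ n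
            * ‖(R : ℂ) ^ n + (r : ℂ) ^ n * bnPhi n k R r α β‖
          + ‖1 + bnPhi n k R r α β‖ * ‖l₀‖) * maxMod k P := by
  have hb := norm_bnPhi_le n hk0 hr hR hα hβ
  set b := bnPhi n k R r α β
  have hval : ∀ w, (bnOp n l₀ l₁ l₂ (P.comp (C (R : ℂ) * X))).eval w
        + b * (bnOp n l₀ l₁ l₂ (P.comp (C (r : ℂ) * X))).eval w
      = (bnOp n l₀ l₁ l₂ (dilatePair R r b P)).eval w := by
    intro w
    rw [dilatePair, bnOp_add, bnOp_C_mul, eval_add, eval_mul, eval_C]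
  rw [hval]
  -- The strict growth estimate needs degree at least `1`. For `n = 0`, `P` is constant and `B` is
  -- multiplication by `λ₀`.
  rcases Nat.eq_zero_or_pos n with rfl | hn
  · obtain ⟨c, rfl⟩ : ∃ c, P = C c := ⟨_, eq_C_of_natDegree_le_zero hdeg⟩
    have hc : ‖c‖ ≤ maxMod k (C c) := by
      simpa using norm_eval_le_maxMod hk0 (C c) (w := 0) (by simpa using hk0.le)
    have e : (bnOp 0 l₀ l₁ l₂ (dilatePair R r b (C c))).eval z = (1 + b) * l₀ * c := by
      rw [bnOp_eval, dilatePair_eval]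
      simp
      ring
    rw [e, norm_mul, norm_mul]
    have := mul_le_mul_of_nonneg_left hc (mul_nonneg (norm_nonneg (1 + b)) (norm_nonneg l₀))
    refine this.trans (le_of_eq ?_)
    have e0 : (bnOp 0 l₀ l₁ l₂ (X ^ 0)).eval z = l₀ := by simp [bnOp]
    rw [e0, pow_zero, pow_zero, pow_zero, div_one, one_mul]
    ring
  -- One parameter `t → 1⁺` relaxes both strict conditions: the point `tz` lies outside the closed
  -- unit disk, and `M = maxMod k P + (t - 1)`.
  · have hlim : ∀ t ∈ Set.Ioi (1 : ℝ), ‖(bnOp n l₀ l₁ l₂ (dilatePair R r b P)).eval (t * z)‖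
        ≤ 1 / 2 * (‖(bnOp n l₀ l₁ l₂ (X ^ n)).eval (t * z)‖ / k ^ n
            * ‖(R : ℂ) ^ n + (r : ℂ) ^ n * b‖ + ‖1 + b‖ * ‖l₀‖) * (maxMod k P + (t - 1)) := by
      intro t ht
      have ht1 : 1 < t := ht
      refine norm_bnOp_dilatePair_le_of_maxMod_lt hB hn hk0 hr hR hb hdeg hP (by linarith) ?_
      rw [norm_mul, Complex.norm_real, Real.norm_of_nonneg (by linarith)]
      nlinarith
    have hcont : ∀ p : ℂ[X], Continuous fun t : ℝ => ‖p.eval (t * z)‖ := fun p =>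
      (p.continuous.comp (Complex.continuous_ofReal.mul continuous_const)).norm
    have h1 := ContinuousWithinAt.closure_le (s := Set.Ioi (1 : ℝ)) (x := 1) (by simp)
      (hcont _).continuousWithinAt
      (((((hcont _).div_const _).mul_const _ |>.add_const _ |>.const_mul _).mul
        (by fun_prop)).continuousWithinAt) hlim
    simpa using h1
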